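/- Let $\mu$ be a probability measure on $\mathbb{R}^2$ with finite second moment, mean zero and invertible covariance matrix, and let $\hat\mu(t)=\int e^{i t\cdot x}\,d\mu(x)$ be its characteristic function. Let $X_1,X_2,\dots$ be independent random variables with law $\mu$, let $M_n=X_1+\dots+X_n$, and for $\varepsilon>0$ let $$\tau_\varepsilon:=\min\{n\ge 1:\ |M_n|<\varepsilon\}\in\{1,2,\dots\}\cup\{\infty\}$$ (with $\min\emptyset=\infty$), where $|\cdot|$ is the Euclidean norm. Assume that $\mu$ satisfies the Cramér condition $$\limsup_{|t|\to\infty}|\hat\mu(t)|<1 .$$ Then, almost surely, $\tau_\varepsilon<\infty$ for all $\varepsilon>0$; and, almost surely on the event that the walk never returns exactly to the origin ($M_n\neq 0$ for all $n\ge1$), $$\lim_{\varepsilon\to0^+}\frac{\log\log\tau_\varepsilon}{-\log\varepsilon}=2 .$$ In particular, this limit holds almost surely whenever $\mathbb{P}(M_n=0)=0$ for all $n\ge 1$. -/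

import Mathlib

open MeasureTheory ProbabilityTheory Filter Topology

/-- The Euclidean plane. -/
abbrev Plane : Type := EuclideanSpace ℝ (Fin 2)

/-- The covariance matrix of a law on the plane (meaningful for a finite second moment). -/
noncomputable def planeCovMatrix (μ : Measure Plane) : Matrix (Fin 2) (Fin 2) ℝ :=
  Matrix.of fun i j => cov[fun x : Plane => x i, fun x : Plane => x j; μ]

/-- The Cramér condition: the limit superior of the modulus of the characteristic function
at infinity is strictly less than one. -/
def CramerCondition (μ : Measure Plane) : Prop :=
  limsup (fun t : Plane => ‖charFun μ t‖) (Bornology.cobounded Plane) < 1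

/-- The walk `M n`, the sum of the first `n` steps; the steps are indexed from zero. -/
noncomputable def walk {Ω : Type*} (X : ℕ → Ω → Plane) (n : ℕ) (ω : Ω) : Plane :=
  ∑ i ∈ Finset.range n, X i ω

/-- The first time `n ≥ 1` at which the walk is in the open `ε`-ball about the origin;
it is `⊤` if there is no such time. -/
noncomputable def returnTime {Ω : Type*} (X : ℕ → Ω → Plane) (ε : ℝ) (ω : Ω) : ℕ∞ :=
  ⨅ (n : ℕ) (_ : 1 ≤ n ∧ ‖walk X n ω‖ < ε), (n : ℕ∞)

/-! Everything rests on the two-sided local estimate P(|M_n| < ε) ≍ ε²/n at the origin. Testing the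
law of M_n against a rescaled bump function turns it into a Fourier integral of the n-th power of
the characteristic function. Near zero this power is Gaussian; elsewhere the Cramér condition makes
it at most ρ^n with ρ < 1. The error is therefore exponentially small, and ε may shrink with n
(`exists_measureReal_ball_le`, `exists_le_measureReal_ball`).

Lower bound for τ: for s > 1 the radii (log n)^(-s/2) give probabilities of order 1/(n (log n)^s),
which are summable. By Borel–Cantelli the walk eventually stays outside these balls. If it never
hits 0, its finitely many earlier positions are also excluded for small ε, so log log τ_ε ≥
(2/s)(-log ε) - O(1).

Upper bound: a last-visit decomposition gives (∑_{n ≤ N} P(|M_n| < η)) · P(|M_m| ≥ 2η for 1 ≤ m ≤ N)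
≤ 1, and the sum is at least of order η² log N for the N used. With 2η = 2^(-k), log N ≈ 2^(sk) and
s > 2, the avoidance probabilities are O(2^((2-s)k)), again summable. Letting s decrease to 1 and to
2 respectively along sequences closes the gap. -/

open scoped RealInnerProductSpace

/-! ### Characteristic function near zero -/

/-- The second moment of a law on the plane in a given direction. -/
noncomputable def planeQuadForm (μ : Measure Plane) (t : Plane) : ℝ := ∫ x, ⟪x, t⟫ ^ 2 ∂μ

/-- Being global in x, this supplies the integrable majorant 4‖x‖² for dominated convergence under a
mere second moment; the value 4 is not sharp. -/
lemma norm_exp_I_taylor_two_le (x : ℝ) :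
    ‖Complex.exp (x * Complex.I) - (1 + x * Complex.I - x ^ 2 / 2)‖ ≤ 4 * x ^ 2 := by
  rcases le_or_gt |x| 1 with hx | hx
  · have h := Complex.norm_exp_sub_one_sub_id_le (x := x * Complex.I) (by simpa using hx)
    have h2 : ‖((x : ℂ) ^ 2 / 2)‖ = x ^ 2 / 2 := by
      simp
    have : ‖(x * Complex.I : ℂ)‖ ^ 2 = x ^ 2 := by simp
    rw [this] at h
    calc _ = ‖(Complex.exp (x * Complex.I) - 1 - x * Complex.I) + (x : ℂ) ^ 2 / 2‖ := by
          congr 1; ring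
      _ ≤ _ := norm_add_le _ _
      _ ≤ _ := by rw [h2]; nlinarith [sq_nonneg x]
  · have h1 : ‖Complex.exp (x * Complex.I)‖ = 1 := Complex.norm_exp_ofReal_mul_I x
    have h3 : ‖(1 + x * Complex.I - (x : ℂ) ^ 2 / 2)‖ ≤ 1 + |x| + x ^ 2 / 2 := by
      refine (norm_sub_le _ _).trans ?_
      refine add_le_add ((norm_add_le _ _).trans ?_) ?_
      · simp
      · simp
    refine (norm_sub_le _ _).trans ?_
    rw [h1]
    have := sq_abs x
    nlinarith

lemma isLittleO_exp_I_taylor_two :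
    (fun x : ℝ => Complex.exp (x * Complex.I) - (1 + x * Complex.I - x ^ 2 / 2))
      =o[𝓝 0] fun x => x ^ 2 := by
  have h := (Complex.exp_sub_sum_range_succ_isLittleO_pow 2)
  have ht : Tendsto (fun x : ℝ => (x * Complex.I : ℂ)) (𝓝 0) (𝓝 0) := by
    have : Continuous fun x : ℝ => (x * Complex.I : ℂ) := by fun_prop
    simpa using this.tendsto 0
  have h2 := h.comp_tendsto ht
  refine (h2.congr_left ?_).trans_isBigO ?_
  · intro x
    simp [Finset.sum_range_succ, mul_pow]
    ring
  · refine Asymptotics.isBigO_of_le _ fun x => ?_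
    simp

section

variable {μ : Measure Plane} [IsProbabilityMeasure μ]

lemma integrable_inner_of_memLp (h2 : MemLp (fun x : Plane => x) 2 μ) (t : Plane) :
    Integrable (fun x : Plane => ⟪x, t⟫) μ :=
  (h2.integrable (by norm_num)).inner_const t

omit [IsProbabilityMeasure μ] in
lemma integrable_sq_inner_of_memLp (h2 : MemLp (fun x : Plane => x) 2 μ) (t : Plane) :
    Integrable (fun x : Plane => ⟪x, t⟫ ^ 2) μ :=
  (h2.inner_const t).integrable_sq

/-- Second order expansion at zero of the characteristic function of a centered law. -/
lemma charFun_sub_isLittleO (h2 : MemLp (fun x : Plane => x) 2 μ) (h0 : ∫ x, x ∂μ = 0) :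
    (fun t : Plane => charFun μ t - (1 - (planeQuadForm μ t / 2 : ℝ)))
      =o[𝓝 0] fun t => ‖t‖ ^ 2 := by
  set e : ℝ → ℂ := fun x => Complex.exp (x * Complex.I) - (1 + x * Complex.I - x ^ 2 / 2)
  have hint : ∀ t : Plane, charFun μ t - (1 - (planeQuadForm μ t / 2 : ℝ)) =
      ∫ x, e ⟪x, t⟫ ∂μ := by
    intro t
    have i1 : Integrable (fun x : Plane => Complex.exp (⟪x, t⟫ * Complex.I)) μ := by
      refine (integrable_const (1 : ℝ)).mono' (by fun_prop) (ae_of_all _ fun x => ?_)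
      rw [Complex.norm_exp_ofReal_mul_I]
    have i2 : Integrable (fun x : Plane => ((⟪x, t⟫ : ℝ) : ℂ) * Complex.I) μ :=
      ((integrable_inner_of_memLp h2 t).ofReal).mul_const _
    have i3 : Integrable (fun x : Plane => ((⟪x, t⟫ : ℝ) : ℂ) ^ 2 / 2) μ := by
      have := ((integrable_sq_inner_of_memLp h2 t).ofReal (𝕜 := ℂ)).div_const 2
      simpa using this
    have m : ∫ x, ⟪x, t⟫ ∂μ = 0 := by
      have := integral_inner (𝕜 := ℝ) (h2.integrable (by norm_num)) t
      simp_rw [real_inner_comm t] at this ⊢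
      rw [this, h0, inner_zero_right]
    have i12 : Integrable (fun x : Plane => (1 : ℂ) + ((⟪x, t⟫ : ℝ) : ℂ) * Complex.I) μ :=
      (integrable_const _).add i2
    have key : ∫ x, e ⟪x, t⟫ ∂μ = (∫ x : Plane, Complex.exp (⟪x, t⟫ * Complex.I) ∂μ) -
        ((∫ _ : Plane, (1 : ℂ) ∂μ) + (∫ x : Plane, ((⟪x, t⟫ : ℝ) : ℂ) * Complex.I ∂μ) -
          ∫ x : Plane, ((⟪x, t⟫ : ℝ) : ℂ) ^ 2 / 2 ∂μ) := by
      rw [← integral_add (integrable_const _) i2, ← integral_sub i12 i3,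
        ← integral_sub i1 (by exact i12.sub i3)]
    have hsq : ∫ x : Plane, ((⟪x, t⟫ : ℝ) : ℂ) ^ 2 ∂μ = ((∫ x : Plane, ⟪x, t⟫ ^ 2 ∂μ : ℝ) : ℂ) := by
      rw [← integral_complex_ofReal]; simp
    rw [key, charFun_apply, integral_mul_const, integral_complex_ofReal, m, planeQuadForm,
      integral_div, hsq]
    simp
  rw [← Asymptotics.isLittleO_norm_left, Asymptotics.isLittleO_iff_tendsto (by
    intro t ht
    have : t = 0 := by simpa using ht
    subst this
    simp [charFun_zero, planeQuadForm])]
  have hlim : Tendsto (fun t : Plane => ∫ x, ((‖t‖ ^ 2)⁻¹ : ℝ) • e ⟪x, t⟫ ∂μ) (𝓝 0)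
      (𝓝 (∫ _ : Plane, (0 : ℂ) ∂μ)) := by
    refine tendsto_integral_filter_of_dominated_convergence (fun x => 4 * ‖x‖ ^ 2) ?_ ?_ ?_ ?_
    · exact Eventually.of_forall fun t => by fun_prop
    · refine Eventually.of_forall fun t => ae_of_all _ fun x => ?_
      rcases eq_or_ne t 0 with rfl | ht
      · simp
      have ht : 0 < ‖t‖ := norm_pos_iff.2 ht
      rw [norm_smul, norm_inv, norm_pow, norm_norm, inv_mul_le_iff₀ (by positivity)]
      refine (norm_exp_I_taylor_two_le _).trans ?_
      have h1 := abs_real_inner_le_norm x t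
      have h3 : ⟪x, t⟫ ^ 2 ≤ (‖x‖ * ‖t‖) ^ 2 := sq_le_sq' (by linarith [neg_abs_le ⟪x, t⟫])
        (le_trans (le_abs_self _) h1)
      calc 4 * ⟪x, t⟫ ^ 2 ≤ 4 * (‖x‖ * ‖t‖) ^ 2 := by gcongr
        _ = _ := by ring
    · exact (h2.integrable_norm_pow (by norm_num)).const_mul 4
    · refine ae_of_all _ fun x => ?_
      have hx : Tendsto (fun t : Plane => ⟪x, t⟫) (𝓝 0) (𝓝 0) := by
        have : Continuous fun t : Plane => ⟪x, t⟫ := by fun_prop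
        simpa using this.tendsto 0
      have hO : ((fun y : ℝ => y ^ 2) ∘ fun t : Plane => ⟪x, t⟫) =O[𝓝 0]
          fun t : Plane => ‖t‖ ^ 2 := by
        refine Asymptotics.IsBigO.of_bound (‖x‖ ^ 2) (Eventually.of_forall fun t => ?_)
        simp only [Function.comp, norm_pow, norm_norm, ← mul_pow]
        gcongr
        exact abs_real_inner_le_norm x t
      have ho := (isLittleO_exp_I_taylor_two.comp_tendsto hx).trans_isBigO hO
      rw [tendsto_zero_iff_norm_tendsto_zero]
      have := ho.norm_left.tendsto_div_nhds_zero
      refine this.congr fun t => ?_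
      simp [e, div_eq_inv_mul]
  rw [integral_zero] at hlim
  refine hlim.norm.congr' (Eventually.of_forall fun t => ?_) |>.trans (by simp)
  rw [hint, integral_smul, norm_smul]
  simp [div_eq_inv_mul]

omit [IsProbabilityMeasure μ] in
lemma planeQuadForm_smul (c : ℝ) (t : Plane) :
    planeQuadForm μ (c • t) = c ^ 2 * planeQuadForm μ t := by
  simp only [planeQuadForm, inner_smul_right, mul_pow, integral_const_mul]

omit [IsProbabilityMeasure μ] in
lemma integrable_coord_mul (h2 : MemLp (fun x : Plane => x) 2 μ) (i j : Fin 2) :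
    Integrable (fun x : Plane => x i * x j) μ := by
  have h : ∀ i : Fin 2, MemLp (fun x : Plane => x i) 2 μ := fun i =>
    h2.continuousLinearMap_comp (EuclideanSpace.proj (𝕜 := ℝ) i)
  exact (h i).integrable_mul (h j)

lemma integral_coord_mul (h2 : MemLp (fun x : Plane => x) 2 μ) (h0 : ∫ x, x ∂μ = 0)
    (i j : Fin 2) : ∫ x : Plane, x i * x j ∂μ = planeCovMatrix μ i j := by
  have h : ∀ i : Fin 2, MemLp (fun x : Plane => x i) 2 μ := fun i =>
    h2.continuousLinearMap_comp (EuclideanSpace.proj (𝕜 := ℝ) i)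
  have m : ∀ i : Fin 2, ∫ x : Plane, x i ∂μ = 0 := fun i => by
    have := (EuclideanSpace.proj i : Plane →L[ℝ] ℝ).integral_comp_comm
      (h2.integrable (by norm_num))
    simpa [h0] using this
  rw [planeCovMatrix, Matrix.of_apply, covariance_eq_sub (h i) (h j), m, m]
  simp

lemma planeQuadForm_eq (h2 : MemLp (fun x : Plane => x) 2 μ) (h0 : ∫ x, x ∂μ = 0) (t : Plane) :
    planeQuadForm μ t = ∑ i, ∑ j, t i * t j * planeCovMatrix μ i j := by
  simp_rw [← integral_coord_mul h2 h0, ← integral_const_mul]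
  rw [planeQuadForm]
  have : ∀ x : Plane, ⟪x, t⟫ ^ 2 = ∑ i, ∑ j, t i * t j * (x i * x j) := by
    intro x
    simp [PiLp.inner_apply, Fin.sum_univ_two]
    ring
  simp_rw [this]
  rw [integral_finsetSum _ fun i _ => integrable_finsetSum _ fun j _ =>
    (integrable_coord_mul h2 i j).const_mul _]
  refine Finset.sum_congr rfl fun i _ => ?_
  rw [integral_finsetSum _ fun j _ => (integrable_coord_mul h2 i j).const_mul _]

lemma continuous_planeQuadForm (h2 : MemLp (fun x : Plane => x) 2 μ) (h0 : ∫ x, x ∂μ = 0) :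
    Continuous (planeQuadForm μ) := by
  rw [show planeQuadForm μ = _ from funext (planeQuadForm_eq h2 h0)]
  fun_prop

/-- If the form vanished at t, then ⟪x, t⟫ = 0 almost surely, which would put t in the kernel of the
covariance matrix. -/
lemma planeQuadForm_pos (h2 : MemLp (fun x : Plane => x) 2 μ) (h0 : ∫ x, x ∂μ = 0)
    (hcov : IsUnit (planeCovMatrix μ)) {t : Plane} (ht : t ≠ 0) : 0 < planeQuadForm μ t := by
  refine lt_of_le_of_ne (integral_nonneg fun x => sq_nonneg _) fun h => ht ?_
  have hae := (integral_eq_zero_iff_of_nonneg (fun x => sq_nonneg ⟪x, t⟫)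
    (integrable_sq_inner_of_memLp h2 t)).1 h.symm
  have hz : (planeCovMatrix μ).mulVec t = 0 := by
    ext i
    simp only [Matrix.mulVec, dotProduct, Pi.zero_apply]
    simp_rw [← integral_coord_mul h2 h0, ← integral_mul_const]
    rw [← integral_finsetSum _ fun j _ => (integrable_coord_mul h2 i j).mul_const _]
    refine integral_eq_zero_of_ae ?_
    filter_upwards [hae] with x hx
    have hx : ⟪x, t⟫ = 0 := by simpa using hx
    have : ∑ j, x i * x j * t j = x i * ⟪x, t⟫ := by
      simp [PiLp.inner_apply, Fin.sum_univ_two]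
      ring
    rw [this, hx]
    simp
  have := Matrix.mulVec_injective_of_isUnit hcov (a₁ := t) (a₂ := 0) (by simpa using hz)
  ext i
  exact congrFun this i

lemma exists_mul_sq_norm_le_planeQuadForm (h2 : MemLp (fun x : Plane => x) 2 μ)
    (h0 : ∫ x, x ∂μ = 0) (hcov : IsUnit (planeCovMatrix μ)) :
    ∃ c > 0, ∀ t, c * ‖t‖ ^ 2 ≤ planeQuadForm μ t := by
  have hne : (Metric.sphere (0 : Plane) 1).Nonempty := NormedSpace.sphere_nonempty.2 zero_le_one
  obtain ⟨u, hu, hmin⟩ := (isCompact_sphere (0 : Plane) 1).exists_isMinOn hne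
    (continuous_planeQuadForm h2 h0).continuousOn
  have hu0 : u ≠ 0 := by
    rintro rfl
    simp at hu
  refine ⟨planeQuadForm μ u, planeQuadForm_pos h2 h0 hcov hu0, fun t => ?_⟩
  rcases eq_or_ne t 0 with rfl | ht
  · simp [planeQuadForm]
  have ht' : 0 < ‖t‖ := norm_pos_iff.2 ht
  have h1 : planeQuadForm μ u ≤ planeQuadForm μ (‖t‖⁻¹ • t) :=
    hmin (by simp [norm_smul, ht'.ne'])
  calc planeQuadForm μ u * ‖t‖ ^ 2 ≤ planeQuadForm μ (‖t‖⁻¹ • t) * ‖t‖ ^ 2 := by gcongr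
    _ = planeQuadForm μ t := by rw [planeQuadForm_smul]; field_simp

/-- Gaussian bound near zero for the characteristic function of a centered nondegenerate law. -/
lemma exists_norm_charFun_le_exp (h2 : MemLp (fun x : Plane => x) 2 μ)
    (h0 : ∫ x, x ∂μ = 0) (hcov : IsUnit (planeCovMatrix μ)) :
    ∃ c > 0, ∃ r > 0, ∀ t, ‖t‖ < r → ‖charFun μ t‖ ≤ Real.exp (-c * ‖t‖ ^ 2) := by
  obtain ⟨c, hc, hQ⟩ := exists_mul_sq_norm_le_planeQuadForm h2 h0 hcov
  have h1 := (charFun_sub_isLittleO h2 h0).def (c := c / 4) (by positivity)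
  have hQ0 : planeQuadForm μ 0 = 0 := by simp [planeQuadForm]
  have h3 : ∀ᶠ t in 𝓝 (0 : Plane), planeQuadForm μ t < 2 :=
    (continuous_planeQuadForm h2 h0).tendsto 0 |>.eventually_lt_const (by rw [hQ0]; norm_num)
  obtain ⟨r, hr, hball⟩ := Metric.eventually_nhds_iff.1 (h1.and h3)
  refine ⟨c / 4, by positivity, r, hr, fun t ht => ?_⟩
  obtain ⟨ha, hb⟩ := hball (y := t) (by simpa using ht)
  have hn : ‖(1 - (planeQuadForm μ t / 2 : ℝ) : ℂ)‖ = 1 - planeQuadForm μ t / 2 := by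
    rw [← Complex.ofReal_one, ← Complex.ofReal_sub, Complex.norm_real, Real.norm_of_nonneg]
    linarith
  have hs : ‖charFun μ t‖ ≤ c / 4 * ‖t‖ ^ 2 + (1 - planeQuadForm μ t / 2) := by
    calc ‖charFun μ t‖ = ‖(charFun μ t - (1 - (planeQuadForm μ t / 2 : ℝ))) +
          (1 - (planeQuadForm μ t / 2 : ℝ))‖ := by congr 1; ring
      _ ≤ _ := norm_add_le _ _
      _ ≤ _ := by rw [hn]; simpa using ha
  have := Real.add_one_le_exp (-(c / 4) * ‖t‖ ^ 2)
  linarith [hQ t]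

/-- Central limit theorem for characteristic functions on the plane. -/
lemma tendsto_charFun_inv_sqrt_smul_pow (h2 : MemLp (fun x : Plane => x) 2 μ)
    (h0 : ∫ x, x ∂μ = 0) (v : Plane) :
    Tendsto (fun n : ℕ => charFun μ ((√n)⁻¹ • v) ^ n) atTop
      (𝓝 (Complex.exp (-(planeQuadForm μ v / 2 : ℝ)))) := by
  apply Complex.tendsto_pow_exp_of_isLittleO_sub_add_div
  have ht : Tendsto (fun n : ℕ => (√n)⁻¹ • v) atTop (𝓝 0) := by
    rw [← zero_smul ℝ v]
    exact Tendsto.smul_const (tendsto_inv_atTop_zero.comp <| Real.tendsto_sqrt_atTop.comp <|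
      tendsto_natCast_atTop_atTop) v
  have := (charFun_sub_isLittleO h2 h0).comp_tendsto ht
  refine (this.congr_left fun n => ?_).trans_isBigO ?_
  · simp only [Function.comp, planeQuadForm_smul]
    congr 2
    rw [inv_pow, Real.sq_sqrt (by positivity)]
    push_cast
    ring
  · refine Asymptotics.IsBigO.of_bound (‖v‖ ^ 2) (Eventually.of_forall fun n => ?_)
    simp [norm_smul, mul_pow, abs_of_nonneg]
    rw [mul_comm]

/-! ### Consequences of the Cramér condition -/

/-- After rotation by the conjugate phase, u = w·exp(i⟪x, t⟫) has modulus one and mean one.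
Integrating cos 2θ ≥ 4 cos θ - 3, that is 2(cos θ - 1)² ≥ 0, gives Re E[u²] ≥ 1. -/
lemma norm_charFun_two_smul_eq_one {t : Plane} (ht : ‖charFun μ t‖ = 1) :
    ‖charFun μ ((2 : ℝ) • t)‖ = 1 := by
  refine le_antisymm (norm_charFun_le_one _) ?_
  set w : ℂ := starRingEnd ℂ (charFun μ t)
  have hw : ‖w‖ = 1 := by simpa [w] using ht
  set u : Plane → ℂ := fun x => w * Complex.exp (⟪x, t⟫ * Complex.I)
  have hu : ∀ x, ‖u x‖ = 1 := fun x => by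
    simp only [u, norm_mul, hw, Complex.norm_exp_ofReal_mul_I, one_mul]
  have iu : Integrable u μ :=
    (integrable_const (1 : ℝ)).mono' (by fun_prop) (ae_of_all _ fun x => (hu x).le)
  have iu2 : Integrable (fun x => u x ^ 2) μ :=
    (integrable_const (1 : ℝ)).mono' (by fun_prop) (ae_of_all _ fun x => by simp [hu x])
  have e1 : ∫ x, u x ∂μ = 1 := by
    simp only [u]
    rw [integral_const_mul, ← charFun_apply, mul_comm, Complex.mul_conj, Complex.normSq_eq_norm_sq,
      ht]
    simp
  have e2 : ∫ x, u x ^ 2 ∂μ = w ^ 2 * charFun μ ((2 : ℝ) • t) := by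
    rw [charFun_apply, ← integral_const_mul]
    refine integral_congr_ae (ae_of_all _ fun x => ?_)
    simp only [u, mul_pow, ← Complex.exp_nat_mul, inner_smul_right]
    congr 2
    push_cast
    ring
  have r1 : ∫ x, (u x).re ∂μ = 1 := by
    have := integral_re iu
    simp only [RCLike.re_eq_complex_re] at this
    rw [this, e1, Complex.one_re]
  have r2 : ∫ x, (u x ^ 2).re ∂μ = (w ^ 2 * charFun μ ((2 : ℝ) • t)).re := by
    have := integral_re iu2
    simp only [RCLike.re_eq_complex_re] at this
    rw [this, e2]
  have hle : ∫ x, (4 * (u x).re - 3) ∂μ ≤ ∫ x, (u x ^ 2).re ∂μ := by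
    refine integral_mono ((iu.re.const_mul 4).sub (integrable_const _)) iu2.re fun x => ?_
    have h := hu x
    have h3 : (u x).re ^ 2 + (u x).im ^ 2 = 1 := by
      have := Complex.sq_norm_sub_sq_re (u x)
      rw [h] at this
      linarith
    simp only [pow_two, Complex.mul_re] at h3 ⊢
    nlinarith [sq_nonneg ((u x).re - 1)]
  have hsub : ∫ x, (4 * (u x).re - 3) ∂μ = 4 * ∫ x, (u x).re ∂μ - 3 := by
    rw [integral_sub (by exact iu.re.const_mul 4) (integrable_const _), integral_const_mul]
    simp
  rw [hsub, r1, r2] at hle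
  have : (w ^ 2 * charFun μ ((2 : ℝ) • t)).re ≤ ‖charFun μ ((2 : ℝ) • t)‖ := by
    refine (Complex.re_le_norm _).trans ?_
    simp [hw]
  linarith

lemma CramerCondition.exists_lt_one (h : CramerCondition μ) :
    ∃ b < 1, ∃ R, ∀ t, R ≤ ‖t‖ → ‖charFun μ t‖ < b := by
  obtain ⟨b, hb, hb1⟩ := exists_between h
  have := eventually_lt_of_limsup_lt hb
    (isBoundedUnder_of ⟨1, fun t => norm_charFun_le_one t⟩)
  rw [← comap_norm_atTop] at this
  obtain ⟨R, hR⟩ := eventually_atTop.1 (eventually_comap.1 this)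
  exact ⟨b, hb1, R, fun t ht => hR _ ht t rfl⟩

/-- Repeated doubling would carry modulus one from t out to infinity, against the Cramér condition.
-/
lemma CramerCondition.norm_charFun_lt_one (h : CramerCondition μ) {t : Plane} (ht : t ≠ 0) :
    ‖charFun μ t‖ < 1 := by
  refine lt_of_le_of_ne (norm_charFun_le_one _) fun h1 => ?_
  obtain ⟨b, hb, R, hR⟩ := h.exists_lt_one
  have hk : ∀ k : ℕ, ‖charFun μ ((2 : ℝ) ^ k • t)‖ = 1 := by
    intro k
    induction k with
    | zero => simpa using h1
    | succ k ih =>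
      have := norm_charFun_two_smul_eq_one ih
      rwa [smul_smul, ← pow_succ'] at this
  obtain ⟨k, hk2⟩ := pow_unbounded_of_one_lt (R / ‖t‖) (one_lt_two (α := ℝ))
  have := hR ((2 : ℝ) ^ k • t) (by
    rw [norm_smul, norm_pow, Real.norm_two]
    exact ((div_lt_iff₀ (norm_pos_iff.2 ht)).1 hk2).le)
  rw [hk k] at this
  linarith

lemma CramerCondition.exists_norm_charFun_le (h : CramerCondition μ) {r : ℝ} (hr : 0 < r) :
    ∃ ρ, 0 < ρ ∧ ρ < 1 ∧ ∀ t, r ≤ ‖t‖ → ‖charFun μ t‖ ≤ ρ := by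
  obtain ⟨b, hb, R, hR⟩ := h.exists_lt_one
  have hcomp : IsCompact (Metric.closedBall (0 : Plane) R \ Metric.ball 0 r) :=
    (isCompact_closedBall _ _).diff Metric.isOpen_ball
  obtain ⟨m, hm, hmax⟩ : ∃ m < 1, ∀ t ∈ Metric.closedBall (0 : Plane) R \ Metric.ball 0 r,
      ‖charFun μ t‖ ≤ m := by
    rcases (Metric.closedBall (0 : Plane) R \ Metric.ball 0 r).eq_empty_or_nonempty with he | hne
    · exact ⟨0, zero_lt_one, by simp [he]⟩
    · obtain ⟨u, hu, hmax⟩ := hcomp.exists_isMaxOn hne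
        (continuous_charFun (μ := μ)).norm.continuousOn
      refine ⟨_, h.norm_charFun_lt_one (t := u) ?_, fun t ht => hmax ht⟩
      rintro rfl
      simp [hr] at hu
  -- Here b serves beyond radius R and m on the compact annulus; 1/2 only makes ρ visibly positive.
  refine ⟨max (1 / 2) (max b m), by positivity, by simp [hb, hm]; norm_num, fun t ht => ?_⟩
  rcases le_total R ‖t‖ with h1 | h1
  · exact (hR t h1).le.trans (by simp)
  · exact (hmax t ⟨by simpa using h1, by simpa using ht⟩).trans (by simp)

end

/-! ### Fourier inversion and smoothing of ball indicators -/

open scoped FourierTransform SchwartzMap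

/-- Integrating a rescaled Schwartz function against a law, through the characteristic function. -/
lemma integral_schwartz_comp_smul (f : 𝓢(Plane, ℂ)) (ν : Measure Plane) [IsProbabilityMeasure ν]
    (b : ℝ) :
    ∫ x, f (b • x) ∂ν = ∫ ξ, 𝓕 f ξ * charFun ν ((2 * Real.pi * b) • ξ) := by
  have h1 : ∀ y, f y = ∫ ξ, Complex.exp ((2 * Real.pi * ⟪ξ, y⟫ : ℝ) * Complex.I) * 𝓕 f ξ := by
    intro y
    have : f y = 𝓕⁻ (𝓕 f) y := by simp
    rw [this, SchwartzMap.fourierInv_coe, Real.fourierInv_eq']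
    simp
  have h2 : ∀ x ξ : Plane, Complex.exp ((2 * Real.pi * ⟪ξ, b • x⟫ : ℝ) * Complex.I) * 𝓕 f ξ =
      𝓕 f ξ * Complex.exp (⟪x, (2 * Real.pi * b) • ξ⟫ * Complex.I) := by
    intro x ξ
    rw [mul_comm, inner_smul_right, inner_smul_right, real_inner_comm]
    ring_nf
  simp_rw [h1 (b • _), h2]
  rw [integral_integral_swap]
  · simp_rw [integral_const_mul, ← charFun_apply]
  · have hi : Integrable (fun p : Plane × Plane => 𝓕 f p.2) (ν.prod volume) :=
      (𝓕 f).integrable.comp_snd ν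
    refine hi.norm.mono' ?_ (ae_of_all _ fun p => ?_)
    · have : Continuous fun ξ => 𝓕 f ξ := (𝓕 f).continuous
      simp only [Function.uncurry_def]
      fun_prop
    · simp [Function.uncurry_def, Complex.norm_exp_ofReal_mul_I]

/-- A smooth bump function on the plane, as a Schwartz function. -/
noncomputable def planeBump : ContDiffBump (0 : Plane) := ⟨1, 2, one_pos, one_lt_two⟩

/-- The Schwartz function attached to `planeBump`. -/
noncomputable def planeBumpSchwartz : 𝓢(Plane, ℂ) :=
  HasCompactSupport.toSchwartzMap (f := fun x => (planeBump x : ℂ))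
    (planeBump.hasCompactSupport.comp_left (g := fun r : ℝ => (r : ℂ)) Complex.ofReal_zero)
    (Complex.ofRealCLM.contDiff.comp planeBump.contDiff)

lemma planeBumpSchwartz_apply (x : Plane) : planeBumpSchwartz x = (planeBump x : ℂ) := rfl

lemma integrable_planeBump_comp (ν : Measure Plane) [IsProbabilityMeasure ν] (b : ℝ) :
    Integrable (fun x => planeBump (b • x)) ν := by
  have := planeBump.continuous
  refine (integrable_const (1 : ℝ)).mono' (by fun_prop) (ae_of_all _ fun x => ?_)
  rw [Real.norm_of_nonneg planeBump.nonneg]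
  exact planeBump.le_one

/-- The bump is 1 on the unit ball and 0 outside radius 2, so the scalings ε⁻¹ here and 2/ε below
sandwich the indicator of the ε-ball. -/
lemma measureReal_ball_le_integral_planeBump (ν : Measure Plane) [IsProbabilityMeasure ν] {ε : ℝ}
    (hε : 0 < ε) : ν.real (Metric.ball 0 ε) ≤ ∫ x, planeBump (ε⁻¹ • x) ∂ν := by
  rw [← integral_indicator_one measurableSet_ball]
  refine integral_mono ((integrable_const 1).indicator measurableSet_ball)
    (integrable_planeBump_comp ν _) fun x => ?_
  by_cases hx : x ∈ Metric.ball (0 : Plane) ε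
  · have hx' : ‖x‖ < ε := by simpa using hx
    have : planeBump (ε⁻¹ • x) = 1 := planeBump.one_of_mem_closedBall (by
      have : ε⁻¹ * ‖x‖ ≤ 1 := by
        rw [inv_mul_le_iff₀ hε]; linarith
      simpa [norm_smul, abs_of_pos hε, planeBump] using this)
    simp [hx, this]
  · simp only [hx, not_false_eq_true, Set.indicator_of_notMem]
    exact planeBump.nonneg

lemma integral_planeBump_le_measureReal_ball (ν : Measure Plane) [IsProbabilityMeasure ν] {ε : ℝ}
    (hε : 0 < ε) : ∫ x, planeBump ((2 / ε) • x) ∂ν ≤ ν.real (Metric.ball 0 ε) := by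
  rw [← integral_indicator_one measurableSet_ball]
  refine integral_mono (integrable_planeBump_comp ν _)
    ((integrable_const 1).indicator measurableSet_ball) fun x => ?_
  by_cases hx : x ∈ Metric.ball (0 : Plane) ε
  · simp only [hx, Set.indicator_of_mem, Pi.one_apply]
    exact planeBump.le_one
  · have hx' : ε ≤ ‖x‖ := by simpa using hx
    have : planeBump ((2 / ε) • x) = 0 := planeBump.zero_of_le_dist (by
      have : 2 ≤ 2 / ε * ‖x‖ := by
        rw [div_mul_eq_mul_div, le_div_iff₀ hε]; linarith
      simpa [norm_smul, abs_of_pos hε, planeBump] using this)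
    simp [hx, this]

lemma ofReal_integral_planeBump (ν : Measure Plane) [IsProbabilityMeasure ν] (b : ℝ) :
    ((∫ x, planeBump (b • x) ∂ν : ℝ) : ℂ) =
      ∫ ξ, 𝓕 planeBumpSchwartz ξ * charFun ν ((2 * Real.pi * b) • ξ) := by
  rw [← integral_schwartz_comp_smul, ← integral_complex_ofReal]
  rfl

lemma fourier_planeBumpSchwartz_zero :
    𝓕 planeBumpSchwartz 0 = ((∫ x, planeBump x : ℝ) : ℂ) := by
  rw [SchwartzMap.fourier_coe, Real.fourier_eq', ← integral_complex_ofReal]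
  simp [planeBumpSchwartz_apply]

lemma integrable_exp_neg_mul_sq_norm {b : ℝ} (hb : 0 < b) :
    Integrable fun v : Plane => Real.exp (-b * ‖v‖ ^ 2) := by
  have := (GaussianFourier.integrable_cexp_neg_mul_sq_norm_add (V := Plane) (b := (b : ℂ))
    (by simpa using hb) 0 0).re
  refine this.congr (ae_of_all _ fun v => ?_)
  simp only [zero_mul, add_zero, RCLike.re_eq_complex_re]
  rw [← Complex.exp_ofReal_re]
  push_cast
  rfl

lemma integral_exp_neg_mul_sq_norm {b : ℝ} (hb : 0 < b) :
    ∫ v : Plane, Real.exp (-b * ‖v‖ ^ 2) = Real.pi / b := by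
  rw [GaussianFourier.integral_rexp_neg_mul_sq_norm hb]
  simp

/-! ### Local limit estimates at the origin -/

section

variable {μ : Measure Plane} [IsProbabilityMeasure μ]

/-- Uniform upper bound in the local limit theorem at the origin. -/
lemma exists_measureReal_ball_le (h2 : MemLp (fun x : Plane => x) 2 μ)
    (h0 : ∫ x, x ∂μ = 0) (hcov : IsUnit (planeCovMatrix μ)) (hcr : CramerCondition μ) :
    ∃ C > 0, ∃ ρ, 0 < ρ ∧ ρ < 1 ∧ ∀ n : ℕ, 1 ≤ n → ∀ ε : ℝ, 0 < ε →
      ∀ ν : Measure Plane, IsProbabilityMeasure ν → (∀ t, charFun ν t = charFun μ t ^ n) →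
        ν.real (Metric.ball 0 ε) ≤ C * (ε ^ 2 / n + ρ ^ n) := by
  obtain ⟨c, hc, r, hr, hnear⟩ := exists_norm_charFun_le_exp h2 h0 hcov
  obtain ⟨ρ, hρ0, hρ1, hfar⟩ := hcr.exists_norm_charFun_le hr
  set G := 𝓕 planeBumpSchwartz
  obtain ⟨S, hS⟩ : ∃ S, ∀ ξ, ‖G ξ‖ ≤ S := by
    obtain ⟨S, hS⟩ := G.decay 0 0
    exact ⟨S, by simpa using hS.2⟩
  have hS0 : 0 ≤ S := (norm_nonneg _).trans (hS 0)
  set T := ∫ ξ, ‖G ξ‖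
  have hT0 : 0 ≤ T := integral_nonneg fun _ => norm_nonneg _
  have hGi : Integrable (fun ξ => ‖G ξ‖) := G.integrable.norm
  -- The Gaussian part integrates to Sπ/B = S/(4πc) · ε²/n and the far part to Tρ^n; the summand 1
  -- secures positivity.
  refine ⟨S / (4 * Real.pi * c) + T + 1, by positivity, ρ, hρ0, hρ1, ?_⟩
  intro n hn ε hε ν _ hν
  have hn' : (0 : ℝ) < n := by exact_mod_cast hn
  set B : ℝ := c * n * (2 * Real.pi * ε⁻¹) ^ 2
  have hB : 0 < B := by positivity
  have hbd : ∀ ξ, ‖G ξ * charFun ν ((2 * Real.pi * ε⁻¹) • ξ)‖ ≤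
      S * Real.exp (-B * ‖ξ‖ ^ 2) + ‖G ξ‖ * ρ ^ n := by
    intro ξ
    rw [norm_mul, hν, norm_pow]
    set t := (2 * Real.pi * ε⁻¹) • ξ
    have ht : ‖t‖ ^ 2 = (2 * Real.pi * ε⁻¹) ^ 2 * ‖ξ‖ ^ 2 := by
      rw [norm_smul, mul_pow, Real.norm_eq_abs, sq_abs]
    rcases lt_or_ge ‖t‖ r with h | h
    · have : ‖charFun μ t‖ ^ n ≤ Real.exp (-B * ‖ξ‖ ^ 2) := by
        calc ‖charFun μ t‖ ^ n ≤ Real.exp (-c * ‖t‖ ^ 2) ^ n := by gcongr; exact hnear t h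
          _ = _ := by
            rw [← Real.exp_nat_mul, ht]
            congr 1
            simp only [B]
            ring
      have h3 : ‖G ξ‖ * ‖charFun μ t‖ ^ n ≤ S * Real.exp (-B * ‖ξ‖ ^ 2) := by
        gcongr
        exact hS ξ
      have : 0 ≤ ‖G ξ‖ * ρ ^ n := by positivity
      linarith
    · have h3 : ‖G ξ‖ * ‖charFun μ t‖ ^ n ≤ ‖G ξ‖ * ρ ^ n := by
        gcongr
        exact hfar t h
      have : 0 ≤ S * Real.exp (-B * ‖ξ‖ ^ 2) := by positivity
      linarith
  have h3 : ∫ x, planeBump (ε⁻¹ • x) ∂ν ≤ S * (Real.pi / B) + T * ρ ^ n := by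
    calc ∫ x, planeBump (ε⁻¹ • x) ∂ν ≤ ‖((∫ x, planeBump (ε⁻¹ • x) ∂ν : ℝ) : ℂ)‖ := by
          rw [Complex.norm_real]; exact le_abs_self _
      _ ≤ ∫ ξ, (S * Real.exp (-B * ‖ξ‖ ^ 2) + ‖G ξ‖ * ρ ^ n) := by
          rw [ofReal_integral_planeBump]
          exact norm_integral_le_of_norm_le
            (((integrable_exp_neg_mul_sq_norm hB).const_mul S).add (hGi.mul_const _))
            (ae_of_all _ hbd)
      _ = _ := by
          rw [integral_add ((integrable_exp_neg_mul_sq_norm hB).const_mul S) (hGi.mul_const _),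
            integral_const_mul, integral_mul_const, integral_exp_neg_mul_sq_norm hB]
  have hpi := Real.pi_pos
  have h4 : S * (Real.pi / B) = S / (4 * Real.pi * c) * (ε ^ 2 / n) := by
    simp only [B]
    field_simp
    ring
  refine (measureReal_ball_le_integral_planeBump ν hε).trans (h3.trans ?_)
  rw [h4, mul_add]
  have : 0 ≤ S / (4 * Real.pi * c) := by positivity
  gcongr <;> linarith

/-- The local limit theorem at the origin, for a Schwartz function rescaled by `b`, uniformly
in `1 ≤ b ≤ 2 n`. -/
lemma tendsto_mul_integral_fourier_charFun_pow (h2 : MemLp (fun x : Plane => x) 2 μ)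
    (h0 : ∫ x, x ∂μ = 0) (hcov : IsUnit (planeCovMatrix μ)) (hcr : CramerCondition μ)
    (f : 𝓢(Plane, ℂ)) :
    Tendsto (fun p : ℕ × ℝ => ((p.1 * p.2 ^ 2 : ℝ) : ℂ) *
        ∫ ξ, f ξ * charFun μ ((2 * Real.pi * p.2) • ξ) ^ p.1)
      (comap Prod.fst atTop ⊓ 𝓟 {p : ℕ × ℝ | 1 ≤ p.2 ∧ p.2 ≤ 2 * p.1})
      (𝓝 (∫ u, f 0 * Complex.exp (-(planeQuadForm μ ((2 * Real.pi) • u) / 2 : ℝ)))) := by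
  obtain ⟨c, hc, r, hr, hnear⟩ := exists_norm_charFun_le_exp h2 h0 hcov
  obtain ⟨ρ, hρ0, hρ1, hfar⟩ := hcr.exists_norm_charFun_le hr
  obtain ⟨S, hS⟩ : ∃ S, ∀ ξ, ‖f ξ‖ ≤ S := by
    obtain ⟨S, hS⟩ := f.decay 0 0
    exact ⟨S, by simpa using hS.2⟩
  have hpi := Real.pi_pos
  set l := comap (Prod.fst : ℕ × ℝ → ℕ) atTop ⊓ 𝓟 {p : ℕ × ℝ | 1 ≤ p.2 ∧ p.2 ≤ 2 * p.1}
  have hfst : Tendsto (Prod.fst : ℕ × ℝ → ℕ) l atTop := tendsto_comap.mono_left inf_le_left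
  have hT : ∀ᶠ p in l, 1 ≤ p.2 ∧ p.2 ≤ 2 * (p.1 : ℝ) := eventually_inf_principal.2 (by simp)
  have hn1 : ∀ᶠ p in l, 1 ≤ p.1 := hfst.eventually_ge_atTop 1
  have hsq : Tendsto (fun p : ℕ × ℝ => (√(p.1 : ℝ))⁻¹) l (𝓝 0) :=
    tendsto_inv_atTop_zero.comp <| Real.tendsto_sqrt_atTop.comp <|
      tendsto_natCast_atTop_atTop.comp hfst
  -- With p = (n, b), this is the integrand after substituting u = b√n ξ: the scale b leaves the
  -- characteristic function and survives only in the argument of f. On `A p` the Gaussian bound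
  -- applies.
  set F : ℕ × ℝ → Plane → ℂ := fun p u =>
    f ((p.2 * √(p.1 : ℝ))⁻¹ • u) * charFun μ ((√(p.1 : ℝ))⁻¹ • ((2 * Real.pi) • u)) ^ p.1
  set A : ℕ × ℝ → Set Plane := fun p => {u | ‖(√(p.1 : ℝ))⁻¹ • ((2 * Real.pi) • u)‖ < r}
  have hφ : Continuous (charFun μ) := continuous_charFun
  have hfc : Continuous f := f.continuous
  have hF : ∀ p, Continuous (F p) := fun p => by fun_prop
  have hA : ∀ p, MeasurableSet (A p) := fun p =>
    (isOpen_lt (by fun_prop) (by fun_prop)).measurableSet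
  have hfi : Integrable (fun ξ => ‖f ξ‖) := f.integrable.norm
  have hscale : ∀ p : ℕ × ℝ, 1 ≤ p.1 → 1 ≤ p.2 → ∀ h : Plane → ℝ,
      ∫ u, h ((p.2 * √(p.1 : ℝ))⁻¹ • u) = p.1 * p.2 ^ 2 * ∫ ξ, h ξ := by
    intro p hp1 hp2 h
    rw [Measure.integral_comp_inv_smul]
    have : (√(p.1 : ℝ)) ^ 2 = p.1 := Real.sq_sqrt (by positivity)
    simp [mul_pow, this, mul_comm]
  have hfint : ∀ p : ℕ × ℝ, 1 ≤ p.1 → 1 ≤ p.2 →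
      Integrable (fun u => f ((p.2 * √(p.1 : ℝ))⁻¹ • u)) := by
    intro p hp1 hp2
    have : (0 : ℝ) < p.1 := by exact_mod_cast hp1
    exact f.integrable.comp_smul (by positivity)
  have hFint : ∀ p : ℕ × ℝ, 1 ≤ p.1 → 1 ≤ p.2 → Integrable (F p) := by
    intro p hp1 hp2
    refine (hfint p hp1 hp2).norm.mono' (hF p).aestronglyMeasurable (ae_of_all _ fun u => ?_)
    simp only [F, norm_mul, norm_pow]
    exact mul_le_of_le_one_right (norm_nonneg _)
      (pow_le_one₀ (norm_nonneg _) (norm_charFun_le_one _))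
  have hmain : Tendsto (fun p => ∫ u, (A p).indicator (F p) u) l
      (𝓝 (∫ u, f 0 * Complex.exp (-(planeQuadForm μ ((2 * Real.pi) • u) / 2 : ℝ)))) := by
    refine tendsto_integral_filter_of_dominated_convergence
      (fun u => S * Real.exp (-(c * (2 * Real.pi) ^ 2) * ‖u‖ ^ 2)) ?_ ?_ ?_ ?_
    · exact Eventually.of_forall fun p =>
        (hF p).aestronglyMeasurable.indicator (hA p)
    · filter_upwards [hn1] with p hp
      refine ae_of_all _ fun u => ?_
      have hS0 : 0 ≤ S := (norm_nonneg _).trans (hS 0)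
      by_cases hu : u ∈ A p
      · rw [Set.indicator_of_mem hu]
        simp only [F, norm_mul, norm_pow]
        have hp' : (0 : ℝ) < p.1 := by exact_mod_cast hp
        have hsq : (√(p.1 : ℝ)) ^ 2 = p.1 := Real.sq_sqrt hp'.le
        refine mul_le_mul (hS _) ?_ (by positivity) hS0
        calc _ ≤ Real.exp (-c * ‖(√(p.1 : ℝ))⁻¹ • ((2 * Real.pi) • u)‖ ^ 2) ^ p.1 := by
              gcongr; exact hnear _ hu
          _ = _ := by
            rw [← Real.exp_nat_mul, norm_smul, norm_smul]
            congr 1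
            simp only [norm_inv, Real.norm_eq_abs, mul_pow, inv_pow, sq_abs, hsq]
            field_simp
      · rw [Set.indicator_of_notMem hu, norm_zero]
        positivity
    · exact (integrable_exp_neg_mul_sq_norm (by positivity)).const_mul S
    · refine ae_of_all _ fun u => ?_
      have e1 : Tendsto (fun p : ℕ × ℝ => ‖(√(p.1 : ℝ))⁻¹ • ((2 * Real.pi) • u)‖) l (𝓝 0) := by
        simpa using (hsq.smul_const ((2 * Real.pi) • u)).norm
      have e2 : ∀ᶠ p in l, u ∈ A p := e1.eventually_lt_const hr
      have e3 : Tendsto (fun p : ℕ × ℝ => (p.2 * √(p.1 : ℝ))⁻¹) l (𝓝 0) := by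
        refine squeeze_zero' ?_ ?_ hsq
        · filter_upwards [hT] with p hp
          have : 0 ≤ p.2 := by linarith [hp.1]
          positivity
        · filter_upwards [hT, hn1] with p hp hp1
          have : (0 : ℝ) < p.1 := by exact_mod_cast hp1
          have : 0 < √(p.1 : ℝ) := by positivity
          gcongr
          nlinarith [hp.1]
      have e4 : Tendsto (fun p : ℕ × ℝ => f ((p.2 * √(p.1 : ℝ))⁻¹ • u)) l (𝓝 (f 0)) := by
        refine (hfc.tendsto 0).comp ?_
        simpa using e3.smul_const u
      have e5 := (tendsto_charFun_inv_sqrt_smul_pow h2 h0 ((2 * Real.pi) • u)).comp hfst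
      refine (e4.mul e5).congr' ?_
      filter_upwards [e2] with p hp
      rw [Set.indicator_of_mem hp]
      rfl
  -- Undoing the substitution costs a factor nb². The restriction b ≤ 2n is needed only here, to
  -- bound the error by 4n³ρ^n ∫‖f‖.
  have herr : Tendsto (fun p => ∫ u, (A p)ᶜ.indicator (F p) u) l (𝓝 0) := by
    have hz : Tendsto (fun p : ℕ × ℝ => 4 * ((p.1 : ℝ) ^ 3 * ρ ^ p.1) * ∫ ξ, ‖f ξ‖) l (𝓝 0) := by
      have := (tendsto_pow_const_mul_const_pow_of_abs_lt_one 3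
        (by rwa [abs_of_pos hρ0])).comp hfst
      simpa using (this.const_mul 4).mul_const (∫ ξ, ‖f ξ‖)
    refine squeeze_zero_norm' ?_ hz
    filter_upwards [hT, hn1] with p hp hp1
    calc ‖∫ u, (A p)ᶜ.indicator (F p) u‖ ≤ ∫ u, ‖f ((p.2 * √(p.1 : ℝ))⁻¹ • u)‖ * ρ ^ p.1 := by
          refine norm_integral_le_of_norm_le ((hfint p hp1 hp.1).norm.mul_const _)
            (ae_of_all _ fun u => ?_)
          by_cases hu : u ∈ (A p)ᶜ
          · rw [Set.indicator_of_mem hu]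
            simp only [F, norm_mul, norm_pow]
            gcongr
            exact hfar _ (by simpa [A] using hu)
          · rw [Set.indicator_of_notMem hu, norm_zero]
            positivity
      _ = p.1 * p.2 ^ 2 * (∫ ξ, ‖f ξ‖) * ρ ^ p.1 := by
          rw [integral_mul_const, hscale p hp1 hp.1 fun ξ => ‖f ξ‖]
      _ ≤ p.1 * (2 * p.1) ^ 2 * (∫ ξ, ‖f ξ‖) * ρ ^ p.1 := by
          have : 0 ≤ p.2 := by linarith [hp.1]
          have : 0 ≤ ∫ ξ, ‖f ξ‖ := integral_nonneg fun _ => norm_nonneg _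
          gcongr
          exact hp.2
      _ = _ := by ring
  have hsum := hmain.add herr
  rw [add_zero] at hsum
  refine hsum.congr' ?_
  filter_upwards [hT, hn1] with p hp hp1
  have hp' : (0 : ℝ) < p.1 := by exact_mod_cast hp1
  have hp2 : 0 < p.2 := by linarith [hp.1]
  rw [← integral_add ((hFint p hp1 hp.1).indicator (hA p))
    ((hFint p hp1 hp.1).indicator (hA p).compl)]
  have hspl : ∀ u, (A p).indicator (F p) u + (A p)ᶜ.indicator (F p) u = F p u := fun u =>
    Set.indicator_self_add_compl_apply _ _ _
  simp_rw [hspl]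
  have := Measure.integral_comp_inv_smul volume
    (fun ξ => f ξ * charFun μ ((2 * Real.pi * p.2) • ξ) ^ p.1) (p.2 * √(p.1 : ℝ))
  have hs : (√(p.1 : ℝ)) ^ 2 = p.1 := Real.sq_sqrt (by positivity)
  have habs : |(p.2 * √(p.1 : ℝ)) ^ Module.finrank ℝ Plane| = p.1 * p.2 ^ 2 := by
    simp [mul_pow, hs, mul_comm]
  rw [habs] at this
  rw [Complex.real_smul] at this
  rw [← this]
  refine integral_congr_ae (ae_of_all _ fun u => ?_)
  simp only [F, smul_smul]
  congr 4
  field_simp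

/-- Uniform lower bound in the local limit theorem at the origin. -/
lemma exists_le_measureReal_ball (h2 : MemLp (fun x : Plane => x) 2 μ)
    (h0 : ∫ x, x ∂μ = 0) (hcov : IsUnit (planeCovMatrix μ)) (hcr : CramerCondition μ) :
    ∃ c > 0, ∃ n₀ : ℕ, ∀ n : ℕ, n₀ ≤ n → ∀ ε : ℝ, 0 < ε → ε ≤ 1 → 1 / ε ≤ n →
      ∀ ν : Measure Plane, IsProbabilityMeasure ν → (∀ t, charFun ν t = charFun μ t ^ n) →
        c * (ε ^ 2 / n) ≤ ν.real (Metric.ball 0 ε) := by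
  have hlim := tendsto_mul_integral_fourier_charFun_pow h2 h0 hcov hcr (𝓕 planeBumpSchwartz)
  obtain ⟨c, hc, hQ⟩ := exists_mul_sq_norm_le_planeQuadForm h2 h0 hcov
  have hQc := continuous_planeQuadForm h2 h0
  have hpi := Real.pi_pos
  set K : ℝ := (∫ x, planeBump x) *
    ∫ u : Plane, Real.exp (-(planeQuadForm μ ((2 * Real.pi) • u) / 2)) with hK
  have hKpos : 0 < K := by
    refine mul_pos planeBump.integral_pos (integral_exp_pos ?_)
    refine (integrable_exp_neg_mul_sq_norm
      (b := c * (2 * Real.pi) ^ 2 / 2) (by positivity)).mono' (by fun_prop) (ae_of_all _ fun u => ?_)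
    rw [Real.norm_of_nonneg (Real.exp_nonneg _)]
    gcongr
    have := hQ ((2 * Real.pi) • u)
    rw [norm_smul, mul_pow, Real.norm_eq_abs, sq_abs] at this
    linarith
  have hKeq : ∫ u, 𝓕 planeBumpSchwartz 0 *
      Complex.exp (-(planeQuadForm μ ((2 * Real.pi) • u) / 2 : ℝ)) = (K : ℂ) := by
    rw [integral_const_mul, fourier_planeBumpSchwartz_zero, hK, Complex.ofReal_mul]
    congr 1
    rw [← integral_complex_ofReal]
    push_cast
    rfl
  rw [hKeq] at hlim
  have hre := (Complex.continuous_re.tendsto _).comp hlim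
  have hev := hre.eventually_const_lt (u := K / 2) (by rw [Complex.ofReal_re]; linarith)
  rw [eventually_inf_principal, eventually_comap] at hev
  obtain ⟨n₀, hn₀⟩ := eventually_atTop.1 hev
  -- The limit theorem is used with b = 2/ε, so b ≤ 2n amounts to 1/ε ≤ n. Half the limit K is kept,
  -- and b² = 4/ε² contributes the remaining factor 1/4.
  refine ⟨K / 8, by positivity, max n₀ 1, fun n hn ε hε hε1 hεn ν _ hν => ?_⟩
  have hn1 : (0 : ℝ) < n := by exact_mod_cast (le_of_max_le_right hn)
  have h := hn₀ n (le_of_max_le_left hn) (n, 2 / ε) rfl (by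
    refine ⟨by rw [le_div_iff₀ hε]; linarith, ?_⟩
    calc 2 / ε = 2 * (1 / ε) := by ring
      _ ≤ 2 * n := by gcongr)
  refine le_trans ?_ (integral_planeBump_le_measureReal_ball ν hε)
  have hb := ofReal_integral_planeBump ν (2 / ε)
  simp_rw [hν] at hb
  simp only [Function.comp, ← hb, ← Complex.ofReal_mul, Complex.ofReal_re] at h
  set I := ∫ x, planeBump ((2 / ε) • x) ∂ν
  have h4 : K / 8 * (ε ^ 2 / n) = K / 2 * ((ε / 2) ^ 2 / n) := by ring
  rw [h4]
  have h5 : I = (n * (2 / ε) ^ 2 * I) * ((ε / 2) ^ 2 / n) := by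
    field_simp
  rw [h5]
  gcongr

end

/-! ### Independence of increments and the last-visit inequality -/

section

variable {Ω : Type*} [MeasurableSpace Ω] {P : Measure Ω} [IsProbabilityMeasure P]
  {μ : Measure Plane} [IsProbabilityMeasure μ] {X : ℕ → Ω → Plane}

omit [IsProbabilityMeasure P] [IsProbabilityMeasure μ] in
lemma aemeasurable_walk (hlaw : ∀ i, HasLaw (X i) μ P) (n : ℕ) : AEMeasurable (walk X n) P :=
  Finset.aemeasurable_fun_sum _ fun i _ => (hlaw i).aemeasurable

omit [IsProbabilityMeasure P] [IsProbabilityMeasure μ] in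
lemma charFun_map_walk (hlaw : ∀ i, HasLaw (X i) μ P) (hindep : iIndepFun X P) (n : ℕ)
    (t : Plane) : charFun (P.map (walk X n)) t = charFun μ t ^ n := by
  have := (hindep.restrict (Finset.range n)).charFun_map_fun_finsetSum_eq_prod
    fun i _ => (hlaw i).aemeasurable
  change charFun (P.map fun ω => ∑ i ∈ Finset.range n, X i ω) t = _
  rw [this]
  simp [(hlaw _).map_eq]

omit [IsProbabilityMeasure P] [IsProbabilityMeasure μ] in
lemma measureReal_map_walk_ball (hlaw : ∀ i, HasLaw (X i) μ P) (n : ℕ) (ε : ℝ) :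
    (P.map (walk X n)).real (Metric.ball 0 ε) = P.real {ω | ‖walk X n ω‖ < ε} := by
  rw [measureReal_def, Measure.map_apply_of_aemeasurable (aemeasurable_walk hlaw n)
    measurableSet_ball, measureReal_def]
  congr 2
  ext ω
  simp

omit [IsProbabilityMeasure P] [IsProbabilityMeasure μ] in
lemma measure_avoid_shift (hlaw : ∀ i, HasLaw (X i) μ P) (hindep : iIndepFun X P) (n N : ℕ)
    (r : ℝ) :
    P {ω | ∀ m, 1 ≤ m → m ≤ N → r ≤ ‖walk (fun i => X (n + i)) m ω‖} =
      P {ω | ∀ m, 1 ≤ m → m ≤ N → r ≤ ‖walk X m ω‖} := by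
  have hid : IdentDistrib (fun ω i => X (n + i) ω) (fun ω i => X i ω) P P :=
    IdentDistrib.pi (fun i => ⟨(hlaw _).aemeasurable, (hlaw _).aemeasurable,
      by rw [(hlaw _).map_eq, (hlaw _).map_eq]⟩)
      (hindep.precomp (g := fun i => n + i) (add_right_injective n)) hindep
  have hs : MeasurableSet {x : ℕ → Plane | ∀ m, 1 ≤ m → m ≤ N →
      r ≤ ‖∑ i ∈ Finset.range m, x i‖} := by
    simp only [Set.ofPred_forall]
    refine MeasurableSet.iInter fun m => MeasurableSet.iInter fun _ => MeasurableSet.iInter fun _ =>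
      measurableSet_le measurable_const (by fun_prop)
  exact hid.measure_mem_eq hs

omit [IsProbabilityMeasure P] [IsProbabilityMeasure μ] in
lemma measure_walk_inter_avoid_shift (hlaw : ∀ i, HasLaw (X i) μ P) (hindep : iIndepFun X P)
    (n N : ℕ) (η r : ℝ) :
    P ({ω | ‖walk X n ω‖ < η} ∩
      {ω | ∀ m, 1 ≤ m → m ≤ N → r ≤ ‖walk (fun i => X (n + i)) m ω‖}) =
    P {ω | ‖walk X n ω‖ < η} *
      P {ω | ∀ m, 1 ≤ m → m ≤ N → r ≤ ‖walk (fun i => X (n + i)) m ω‖} := by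
  have hind := hindep.indepFun_finset₀ (Finset.range n) (Finset.Ico n (n + N))
    (by
      rw [Finset.disjoint_left]
      intro i hi
      simp only [Finset.mem_range, Finset.mem_Ico] at hi ⊢
      omega) fun i => (hlaw i).aemeasurable
  -- Independence is applied to two finite blocks of steps. Padding the second block by 0 is
  -- harmless, since walks of length m ≤ N read only entries inside it.
  set ext : (Finset.Ico n (n + N) → Plane) → ℕ → Plane := fun y i =>
    if h : n + i ∈ Finset.Ico n (n + N) then y ⟨n + i, h⟩ else 0 with hext
  have hextm : ∀ i, Measurable fun y => ext y i := by
    intro i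
    by_cases h : n + i ∈ Finset.Ico n (n + N)
    · simp only [hext, h, dif_pos]
      fun_prop
    · simp only [hext, h, dif_neg, not_false_eq_true]
      fun_prop
  have hs : MeasurableSet {y : Finset.range n → Plane | ‖∑ i, y i‖ < η} :=
    measurableSet_lt (by fun_prop) measurable_const
  have ht : MeasurableSet {y : Finset.Ico n (n + N) → Plane | ∀ m, 1 ≤ m → m ≤ N →
      r ≤ ‖∑ i ∈ Finset.range m, ext y i‖} := by
    simp only [Set.ofPred_forall]
    refine MeasurableSet.iInter fun m => MeasurableSet.iInter fun _ => MeasurableSet.iInter fun _ =>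
      measurableSet_le measurable_const ?_
    exact (Finset.measurable_fun_sum _ fun i _ => hextm i).norm
  have h := hind.measure_inter_preimage_eq_mul _ _ hs ht
  have e1 : (fun ω (i : Finset.range n) => X i ω) ⁻¹' {y | ‖∑ i, y i‖ < η} =
      {ω | ‖walk X n ω‖ < η} := by
    ext ω
    simp only [Set.mem_preimage, Set.mem_ofPred_eq, walk]
    rw [Finset.sum_coe_sort (Finset.range n) fun i => X i ω]
  have e2 : (fun ω (i : Finset.Ico n (n + N)) => X i ω) ⁻¹' {y | ∀ m, 1 ≤ m → m ≤ N →
      r ≤ ‖∑ i ∈ Finset.range m, ext y i‖} =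
      {ω | ∀ m, 1 ≤ m → m ≤ N → r ≤ ‖walk (fun i => X (n + i)) m ω‖} := by
    ext ω
    simp only [Set.mem_preimage, Set.mem_ofPred_eq, walk]
    refine forall_congr' fun m => forall_congr' fun _ => forall_congr' fun hm => ?_
    have : ∑ i ∈ Finset.range m, ext (fun j => X j ω) i = ∑ i ∈ Finset.range m, X (n + i) ω := by
      refine Finset.sum_congr rfl fun i hi => ?_
      have : n + i ∈ Finset.Ico n (n + N) := by
        simp only [Finset.mem_range, Finset.mem_Ico] at hi ⊢
        omega
      simp only [hext, this, dif_pos]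
    rw [this]
  rwa [e1, e2] at h

omit [MeasurableSpace Ω] in
lemma walk_add (n m : ℕ) (ω : Ω) :
    walk X (n + m) ω = walk X n ω + walk (fun i => X (n + i)) m ω := by
  simp only [walk, Finset.sum_range_add]

omit [IsProbabilityMeasure μ] in
/-- The last-visit inequality of Dvoretzky and Erdős. -/
lemma sum_measureReal_mul_measureReal_avoid_le_one (hlaw : ∀ i, HasLaw (X i) μ P)
    (hindep : iIndepFun X P) (N : ℕ) (η : ℝ) :
    (∑ n ∈ Finset.range (N + 1), P.real {ω | ‖walk X n ω‖ < η}) *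
      P.real {ω | ∀ m, 1 ≤ m → m ≤ N → 2 * η ≤ ‖walk X m ω‖} ≤ 1 := by
  set A : ℕ → Set Ω := fun n => {ω | ‖walk X n ω‖ < η}
  set B : ℕ → Set Ω := fun n =>
    {ω | ∀ m, 1 ≤ m → m ≤ N → 2 * η ≤ ‖walk (fun i => X (n + i)) m ω‖}
  have hA : ∀ n, NullMeasurableSet (A n) P := fun n =>
    (nullMeasurableSet_lt (aemeasurable_walk hlaw n).norm aemeasurable_const)
  have hB : ∀ n, NullMeasurableSet (B n) P := fun n => by
    simp only [B, Set.ofPred_forall]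
    exact NullMeasurableSet.iInter fun m => NullMeasurableSet.iInter fun _ =>
      NullMeasurableSet.iInter fun _ => nullMeasurableSet_le aemeasurable_const
        (aemeasurable_walk (X := fun i => X (n + i)) (fun i => hlaw _) m).norm
  -- Lying in the η-ball at both times means a displacement below 2η within N steps of time n, which
  -- `B n` forbids.
  have hdisj : ∀ n n', n < n' → n' ≤ N → Disjoint (A n ∩ B n) (A n' ∩ B n') := by
    intro n n' hlt hle
    rw [Set.disjoint_left]
    rintro ω ⟨h1, h2⟩ ⟨h3, -⟩
    have h4 := h2 (n' - n) (by omega) (by omega)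
    have h5 := walk_add (X := X) n (n' - n) ω
    rw [Nat.add_sub_cancel' hlt.le] at h5
    have h6 : walk (fun i => X (n + i)) (n' - n) ω = walk X n' ω - walk X n ω := by
      rw [h5]; abel
    have h7 := norm_sub_le (walk X n' ω) (walk X n ω)
    rw [← h6] at h7
    have h1' : ‖walk X n ω‖ < η := h1
    have h3' : ‖walk X n' ω‖ < η := h3
    linarith
  have hpair : Set.Pairwise (↑(Finset.range (N + 1))) 
      (Function.onFun (AEDisjoint P) fun n => A n ∩ B n) := by
    intro n hn n' hn' hne
    simp only [Finset.coe_range, Set.mem_Iio] at hn hn'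
    rcases lt_or_gt_of_ne hne with h | h
    · exact (hdisj n n' h (by omega)).aedisjoint
    · exact (hdisj n' n h (by omega)).symm.aedisjoint
  have hU := measure_biUnion_finset₀ hpair fun n _ => (hA n).inter (hB n)
  have hB0 : {ω | ∀ m, 1 ≤ m → m ≤ N → 2 * η ≤ ‖walk X m ω‖} = B 0 := by
    simp [B]
  have hAB : ∀ n, P (A n ∩ B n) = P (A n) * P (B 0) := fun n => by
    rw [← hB0, ← measure_avoid_shift hlaw hindep n N (2 * η)]
    exact measure_walk_inter_avoid_shift hlaw hindep n N η (2 * η)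
  simp_rw [hAB] at hU
  rw [← Finset.sum_mul] at hU
  have hle : (∑ n ∈ Finset.range (N + 1), P (A n)) * P (B 0) ≤ 1 := hU ▸ prob_le_one
  rw [hB0]
  have := ENNReal.toReal_mono ENNReal.one_ne_top hle
  rw [ENNReal.toReal_mul, ENNReal.toReal_sum fun n _ => measure_ne_top P _] at this
  simpa [measureReal_def] using this

end

/-! ### Summability and Borel–Cantelli -/

lemma ae_eventually_notMem_of_summable {Ω : Type*} [MeasurableSpace Ω] {P : Measure Ω}
    [IsFiniteMeasure P] {A : ℕ → Set Ω} (h : Summable fun n => P.real (A n)) :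
    ∀ᵐ ω ∂P, ∀ᶠ n in atTop, ω ∉ A n := by
  refine ae_eventually_notMem ?_
  have : ∀ n, P (A n) = ENNReal.ofReal (P.real (A n)) := fun n => by simp
  simp_rw [this]
  exact h.tsum_ofReal_ne_top

/-- Cauchy condensation compares the series with ∑ k^(-s). The shift by 2 keeps the logarithm
positive for every n. -/
lemma summable_log_rpow_div {s : ℝ} (hs : 1 < s) :
    Summable fun n : ℕ => Real.log (n + 2) ^ (-s) / n := by
  have hlog : ∀ n : ℕ, 0 < Real.log ((n : ℝ) + 2) := fun n =>
    Real.log_pos (by have : (0 : ℝ) ≤ n := n.cast_nonneg; linarith)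
  rw [← summable_condensed_iff_of_nonneg]
  · have h1 : Summable fun k : ℕ => Real.log 2 ^ (-s) * (k : ℝ) ^ (-s) :=
      (Real.summable_nat_rpow.2 (by linarith)).mul_left _
    refine h1.of_norm_bounded_eventually_nat ?_
    filter_upwards [eventually_ge_atTop 1] with k hk
    have hk' : (0 : ℝ) < k := by exact_mod_cast hk
    have hl2 : 0 < Real.log 2 := Real.log_pos one_lt_two
    have e : (2 : ℝ) ^ k * (Real.log (((2 ^ k : ℕ) : ℝ) + 2) ^ (-s) / ((2 ^ k : ℕ) : ℝ)) =
        Real.log (((2 ^ k : ℕ) : ℝ) + 2) ^ (-s) := by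
      push_cast
      field_simp
    rw [e, Real.norm_of_nonneg (Real.rpow_nonneg (hlog _).le _),
      ← Real.mul_rpow hl2.le hk'.le]
    refine Real.rpow_le_rpow_of_nonpos (by positivity) ?_ (by linarith)
    rw [mul_comm, ← Real.log_pow]
    refine Real.log_le_log (by positivity) ?_
    push_cast
    linarith
  · intro n
    exact div_nonneg (Real.rpow_nonneg (hlog n).le _) n.cast_nonneg
  · intro m n hm hmn
    have hm' : (0 : ℝ) < m := by exact_mod_cast hm
    have hmn' : (m : ℝ) ≤ n := by exact_mod_cast hmn
    refine div_le_div₀ (Real.rpow_nonneg (hlog m).le _) ?_ hm' hmn'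
    refine Real.rpow_le_rpow_of_nonpos (hlog m) ?_ (by linarith)
    exact Real.log_le_log (by linarith) (by linarith)

lemma log_sub_log_le_sum_Ico_inv {a b : ℕ} (ha : 1 ≤ a) (hab : a ≤ b) :
    Real.log b - Real.log a ≤ ∑ n ∈ Finset.Ico a b, (1 : ℝ) / n := by
  induction b, hab using Nat.le_induction with
  | base => simp
  | succ b hb ih =>
    rw [Finset.sum_Ico_succ_top hb]
    have hb' : (0 : ℝ) < b := by exact_mod_cast (lt_of_lt_of_le ha hb)
    have h := Real.log_le_sub_one_of_pos (x := ((b + 1 : ℕ) : ℝ) / b) (by positivity)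
    rw [Real.log_div (by positivity) hb'.ne'] at h
    have e : ((b + 1 : ℕ) : ℝ) / b - 1 = 1 / b := by
      push_cast
      field_simp
      ring
    rw [e] at h
    linarith

section

variable {Ω : Type*} [MeasurableSpace Ω] {P : Measure Ω} [IsProbabilityMeasure P]
  {μ : Measure Plane} [IsProbabilityMeasure μ] {X : ℕ → Ω → Plane}

/-- The walk eventually stays outside balls with slowly decreasing radii. -/
lemma ae_eventually_log_rpow_le_norm_walk (hlaw : ∀ i, HasLaw (X i) μ P) (hindep : iIndepFun X P)
    (h2 : MemLp (fun x : Plane => x) 2 μ) (h0 : ∫ x, x ∂μ = 0)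
    (hcov : IsUnit (planeCovMatrix μ)) (hcr : CramerCondition μ) {s : ℝ} (hs : 1 < s) :
    ∀ᵐ ω ∂P, ∀ᶠ n : ℕ in atTop, Real.log (n + 2) ^ (-(s / 2)) ≤ ‖walk X n ω‖ := by
  obtain ⟨C, hC, ρ, hρ0, hρ1, hup⟩ := exists_measureReal_ball_le h2 h0 hcov hcr
  have hsum : Summable fun n : ℕ => P.real {ω | ‖walk X n ω‖ < Real.log (n + 2) ^ (-(s / 2))} := by
    refine (((summable_log_rpow_div hs).add
      (summable_geometric_of_lt_one hρ0.le hρ1)).mul_left C).of_norm_bounded_eventually_nat ?_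
    filter_upwards [eventually_ge_atTop 1] with n hn
    have hl : 0 < Real.log ((n : ℝ) + 2) :=
      Real.log_pos (by have : (0 : ℝ) ≤ n := n.cast_nonneg; linarith)
    have := hup n hn (Real.log (n + 2) ^ (-(s / 2))) (by positivity) (P.map (walk X n))
      (Measure.isProbabilityMeasure_map (aemeasurable_walk hlaw n)) (charFun_map_walk hlaw hindep n)
    rw [measureReal_map_walk_ball hlaw, ← Real.rpow_natCast, ← Real.rpow_mul hl.le] at this
    rw [Real.norm_of_nonneg measureReal_nonneg]
    convert this using 5
    push_cast
    ring
  filter_upwards [ae_eventually_notMem_of_summable hsum] with ω hω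
  filter_upwards [hω] with n hn
  simpa using hn

/-- The walk visits small balls within doubly exponential time. -/
lemma ae_eventually_exists_norm_walk_lt (hlaw : ∀ i, HasLaw (X i) μ P) (hindep : iIndepFun X P)
    (h2 : MemLp (fun x : Plane => x) 2 μ) (h0 : ∫ x, x ∂μ = 0)
    (hcov : IsUnit (planeCovMatrix μ)) (hcr : CramerCondition μ) {s : ℝ} (hs : 2 < s) :
    ∀ᵐ ω ∂P, ∀ᶠ k : ℕ in atTop, ∃ m : ℕ, 1 ≤ m ∧ (m : ℝ) ≤ Real.exp ((2 : ℝ) ^ (s * k)) ∧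
      ‖walk X m ω‖ < (1 / 2) ^ k := by
  obtain ⟨c, hc, n₀, hlow⟩ := exists_le_measureReal_ball h2 h0 hcov hcr
  set N : ℕ → ℕ := fun k => ⌊Real.exp ((2 : ℝ) ^ (s * k))⌋₊
  set η : ℕ → ℝ := fun k => (1 / 2) ^ (k + 1) with hη
  have hη2 : ∀ k, 2 * η k = (1 / 2) ^ k := fun k => by
    simp only [hη, pow_succ]
    ring
  -- This will show that discarding the times before `a` costs at most half of log N, because 4^k ≤
  -- 2^(sk).
  have hgrow : ∀ᶠ k : ℕ in atTop, Real.log (n₀ + 2) + k ≤ 1 / 2 * (4 : ℝ) ^ k := by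
    have o1 : (fun _ : ℕ => Real.log (n₀ + 2)) =o[atTop] fun k : ℕ => (4 : ℝ) ^ k :=
      (Asymptotics.isLittleO_const_left.2 (Or.inr
        (tendsto_norm_atTop_atTop.comp (tendsto_pow_atTop_atTop_of_one_lt (by norm_num)))))
    have o2 : (fun k : ℕ => (k : ℝ)) =o[atTop] fun k : ℕ => (4 : ℝ) ^ k :=
      isLittleO_coe_const_pow_of_one_lt (by norm_num)
    filter_upwards [(o1.add o2).def (c := 1 / 2) (by norm_num)] with k hk
    rw [Real.norm_of_nonneg (by positivity : (0 : ℝ) ≤ 4 ^ k)] at hk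
    exact (le_abs_self _).trans hk
  -- The expected number of visits is at least cη² · 2^(sk)/2 with η² = 4^(-k)/4; its reciprocal is
  -- the right-hand side.
  have hbound : ∀ᶠ k : ℕ in atTop,
      P.real {ω | ∀ m, 1 ≤ m → m ≤ N k → 2 * η k ≤ ‖walk X m ω‖} ≤
        8 / c * ((2 : ℝ) ^ (2 - s)) ^ k := by
    filter_upwards [hgrow] with k hk
    set E : ℝ := (2 : ℝ) ^ (s * k)
    have hE4 : (4 : ℝ) ^ k ≤ E := by
      have : (4 : ℝ) ^ k = (2 : ℝ) ^ ((2 : ℝ) * k) := by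
        rw [Real.rpow_mul (by norm_num), Real.rpow_natCast]
        norm_num
      rw [this]
      exact Real.rpow_le_rpow_of_exponent_le (by norm_num) (by gcongr)
    have hEpos : 0 < E := Real.rpow_pos_of_pos (by norm_num) _
    have hηpos : 0 < η k := by positivity
    -- From this time on the lower local estimate applies, since 1/η = 2^(k+1).
    set a : ℕ := max n₀ (2 ^ (k + 1))
    have ha1 : 1 ≤ a := le_max_of_le_right Nat.one_le_two_pow
    have hN : E ≤ Real.log ((N k + 1 : ℕ) : ℝ) := by
      rw [Real.le_log_iff_exp_le (by positivity)]
      push_cast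
      exact (Nat.lt_floor_add_one _).le
    have hla : Real.log a ≤ 1 / 2 * E := by
      have ha : (a : ℝ) ≤ (n₀ + 2) * 2 ^ k := by
        have : a ≤ (n₀ + 2) * 2 ^ k := by
          refine max_le ?_ ?_
          · calc n₀ ≤ n₀ * 2 ^ k := Nat.le_mul_of_pos_right _ (by positivity)
              _ ≤ _ := by gcongr; omega
          · rw [pow_succ, mul_comm]
            gcongr
            omega
        exact_mod_cast this
      have h1 := Real.log_le_log (by positivity) ha
      rw [Real.log_mul (by positivity) (by positivity), Real.log_pow] at h1
      have h3 : Real.log 2 ≤ 1 := by linarith [Real.log_two_lt_d9]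
      have h4 : (k : ℝ) * Real.log 2 ≤ k := mul_le_of_le_one_right k.cast_nonneg h3
      linarith
    have haN : a ≤ N k + 1 := by
      have : Real.log a ≤ Real.log ((N k + 1 : ℕ) : ℝ) := by linarith
      have := (Real.log_le_log_iff (by positivity) (by positivity)).1 this
      exact_mod_cast this
    have hS : c * η k ^ 2 * (1 / 2 * E) ≤
        ∑ n ∈ Finset.range (N k + 1), P.real {ω | ‖walk X n ω‖ < η k} := by
      calc c * η k ^ 2 * (1 / 2 * E)
          ≤ c * η k ^ 2 * ∑ n ∈ Finset.Ico a (N k + 1), (1 : ℝ) / n := by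
            gcongr
            linarith [log_sub_log_le_sum_Ico_inv ha1 haN]
        _ = ∑ n ∈ Finset.Ico a (N k + 1), c * (η k ^ 2 / n) := by
            rw [Finset.mul_sum]
            exact Finset.sum_congr rfl fun n _ => by ring
        _ ≤ ∑ n ∈ Finset.Ico a (N k + 1), P.real {ω | ‖walk X n ω‖ < η k} := by
            refine Finset.sum_le_sum fun n hn => ?_
            have hn := (Finset.mem_Ico.1 hn).1
            rw [← measureReal_map_walk_ball hlaw]
            refine hlow n ((le_max_left _ _).trans hn) (η k) hηpos
              (pow_le_one₀ (by norm_num) (by norm_num)) ?_ _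
              (Measure.isProbabilityMeasure_map (aemeasurable_walk hlaw n))
              (charFun_map_walk hlaw hindep n)
            have : (2 : ℝ) ^ (k + 1) ≤ n := by exact_mod_cast (le_max_right _ _).trans hn
            simpa [hη] using this
        _ ≤ _ := by
            refine Finset.sum_le_sum_of_subset_of_nonneg ?_ fun _ _ _ => measureReal_nonneg
            intro n hn
            simp only [Finset.mem_Ico, Finset.mem_range] at hn ⊢
            exact hn.2
    have hDE := sum_measureReal_mul_measureReal_avoid_le_one hlaw hindep (N k) (η k)
    set q := P.real {ω | ∀ m, 1 ≤ m → m ≤ N k → 2 * η k ≤ ‖walk X m ω‖}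
    have hq : 0 ≤ q := measureReal_nonneg
    have h5 : c * η k ^ 2 * (1 / 2 * E) * q ≤ 1 :=
      (mul_le_mul_of_nonneg_right hS hq).trans hDE
    have h6 : ((2 : ℝ) ^ (2 - s)) ^ k = 4 ^ k / E := by
      rw [← Real.rpow_natCast, ← Real.rpow_mul (by norm_num), sub_mul,
        Real.rpow_sub (by norm_num), Real.rpow_mul (by norm_num) 2, Real.rpow_natCast]
      norm_num [E]
    have h7 : η k ^ 2 = 1 / (4 * 4 ^ k) := by
      simp only [hη]
      rw [← pow_mul, mul_comm, pow_mul, pow_succ]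
      norm_num
      rw [one_div, inv_pow]
    rw [h7] at h5
    rw [h6]
    have h8 : 8 / c * (4 ^ k / E) = 1 / (c * (1 / (4 * 4 ^ k)) * (1 / 2 * E)) := by
      field_simp
      norm_num
    rw [h8, le_div_iff₀ (by positivity)]
    linarith
  have hsum : Summable fun k : ℕ =>
      P.real {ω | ∀ m, 1 ≤ m → m ≤ N k → 2 * η k ≤ ‖walk X m ω‖} := by
    have hg : (2 : ℝ) ^ (2 - s) < 1 := Real.rpow_lt_one_of_one_lt_of_neg (by norm_num) (by linarith)
    refine ((summable_geometric_of_lt_one (by positivity) hg).mul_left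
      (8 / c)).of_norm_bounded_eventually_nat ?_
    filter_upwards [hbound] with k hk
    rwa [Real.norm_of_nonneg measureReal_nonneg]
  filter_upwards [ae_eventually_notMem_of_summable hsum] with ω hω
  filter_upwards [hω] with k hk
  simp only [not_forall, not_le] at hk
  obtain ⟨m, hm1, hmN, hm⟩ := hk
  refine ⟨m, hm1, ?_, by rwa [← hη2]⟩
  exact (Nat.le_floor_iff (Real.exp_nonneg _)).1 hmN

end

/-! ### Pathwise passage from visits to return times -/

section

variable {Ω : Type*} {X : ℕ → Ω → Plane} {ω : Ω}

lemma returnTime_le {ε : ℝ} {m : ℕ} (hm : 1 ≤ m) (h : ‖walk X m ω‖ < ε) :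
    returnTime X ε ω ≤ m :=
  iInf₂_le m ⟨hm, h⟩

lemma exists_returnTime_eq {ε : ℝ} (h : returnTime X ε ω < ⊤) :
    ∃ m : ℕ, returnTime X ε ω = m ∧ 1 ≤ m ∧ ‖walk X m ω‖ < ε := by
  classical
  have hex : ∃ m : ℕ, 1 ≤ m ∧ ‖walk X m ω‖ < ε := by
    by_contra hne
    push Not at hne
    refine h.ne (iInf₂_eq_top.2 fun m hm => ?_)
    exact absurd hm.2 (not_lt.2 (hne m hm.1))
  obtain ⟨h1, h2⟩ := Nat.find_spec hex
  refine ⟨Nat.find hex, le_antisymm (returnTime_le h1 h2) ?_, h1, h2⟩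
  exact le_iInf₂ fun m hm => by exact_mod_cast Nat.find_min' hex hm

lemma returnTime_lt_top_of_eventually {s : ℝ}
    (h : ∀ᶠ k : ℕ in atTop, ∃ m : ℕ, 1 ≤ m ∧ (m : ℝ) ≤ Real.exp ((2 : ℝ) ^ (s * k)) ∧
      ‖walk X m ω‖ < (1 / 2) ^ k) {ε : ℝ} (hε : 0 < ε) : returnTime X ε ω < ⊤ := by
  have h1 : ∀ᶠ k : ℕ in atTop, ((1 : ℝ) / 2) ^ k < ε :=
    (tendsto_pow_atTop_nhds_zero_of_lt_one (by norm_num) (by norm_num)).eventually_lt_const hε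
  obtain ⟨k, ⟨m, hm1, -, hm⟩, hk⟩ := (h.and h1).exists
  exact (returnTime_le hm1 (hm.trans hk)).trans_lt (ENat.natCast_lt_top m)

/-- At m = τ_ε the hypothesis gives (log(m + 2))^(-s/2) < ε once m is large; replacing log(m + 2) by
2 log m costs the term log 2. -/
lemma eventually_le_log_log_returnTime (hfin : ∀ ε : ℝ, 0 < ε → returnTime X ε ω < ⊤)
    (hne : ∀ n : ℕ, 1 ≤ n → walk X n ω ≠ 0) {s : ℝ} (hs : 1 < s)
    (h : ∀ᶠ n : ℕ in atTop, Real.log (n + 2) ^ (-(s / 2)) ≤ ‖walk X n ω‖) :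
    ∀ᶠ ε : ℝ in 𝓝[>] 0, 2 / s * (-Real.log ε) - Real.log 2 ≤
      Real.log (Real.log ((returnTime X ε ω).toNat : ℝ)) := by
  obtain ⟨n₀, hn₀⟩ := eventually_atTop.1 h
  have hout : ∀ n : ℕ, 1 ≤ n → ∀ᶠ ε : ℝ in 𝓝[>] 0, ε ≤ ‖walk X n ω‖ := fun n hn =>
    mem_nhdsWithin_of_mem_nhds (Iic_mem_nhds (norm_pos_iff.2 (hne n hn)))
  -- Going up to n₀ + 1 also forces τ_ε ≥ 2, so that log τ_ε > 0 even when n₀ = 0.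
  have hfinset : ∀ᶠ ε : ℝ in 𝓝[>] 0, ∀ n ∈ Finset.Icc 1 (n₀ + 1), ε ≤ ‖walk X n ω‖ :=
    (Finset.eventually_all _).2 fun n hn => hout n (Finset.mem_Icc.1 hn).1
  filter_upwards [hfinset, self_mem_nhdsWithin] with ε hε hε0
  have hε0 : 0 < ε := hε0
  obtain ⟨m, hm, hm1, hmε⟩ := exists_returnTime_eq (hfin ε hε0)
  have hmn : n₀ + 1 < m := by
    by_contra hle
    exact absurd hmε (not_lt.2 (hε m (Finset.mem_Icc.2 ⟨hm1, not_lt.1 hle⟩)))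
  rw [hm, ENat.toNat_natCast]
  have hm2 : (2 : ℝ) ≤ m := by exact_mod_cast (by omega : 2 ≤ m)
  have hl : 0 < Real.log m := Real.log_pos (by linarith)
  have hl2 : 0 < Real.log ((m : ℝ) + 2) := Real.log_pos (by linarith)
  have h1 : Real.log ((m : ℝ) + 2) ^ (-(s / 2)) < ε := (hn₀ m (by omega)).trans_lt hmε
  have h3 := Real.log_lt_log (by positivity) h1
  rw [Real.log_rpow hl2] at h3
  have h4 : Real.log ((m : ℝ) + 2) ≤ 2 * Real.log m := by
    have : 2 * Real.log m = Real.log ((m : ℝ) ^ 2) := by rw [Real.log_pow]; norm_num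
    rw [this]
    refine Real.log_le_log (by linarith) ?_
    nlinarith
  have h5 := Real.log_le_log hl2 h4
  rw [Real.log_mul two_ne_zero hl.ne'] at h5
  have h6 : 2 / s * (-Real.log ε) ≤ Real.log (Real.log ((m : ℝ) + 2)) := by
    rw [div_mul_eq_mul_div, div_le_iff₀ (by linarith)]
    linarith
  linarith

/-- Rounding ε down to a dyadic scale 2^(-k) changes -log ε by at most log 2, whence the additive s
log 2. -/
lemma eventually_log_log_returnTime_le {s : ℝ} (hs : 2 < s)
    (h : ∀ᶠ k : ℕ in atTop, ∃ m : ℕ, 1 ≤ m ∧ (m : ℝ) ≤ Real.exp ((2 : ℝ) ^ (s * k)) ∧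
      ‖walk X m ω‖ < (1 / 2) ^ k) :
    ∀ᶠ ε : ℝ in 𝓝[>] 0, Real.log (Real.log ((returnTime X ε ω).toNat : ℝ)) ≤
      s * (-Real.log ε) + s * Real.log 2 := by
  have hl2 : 0 < Real.log 2 := Real.log_pos one_lt_two
  have hlog : Tendsto (fun ε : ℝ => -Real.log ε) (𝓝[>] 0) atTop :=
    tendsto_neg_atBot_atTop.comp Real.tendsto_log_nhdsGT_zero
  have hceil : Tendsto (fun ε : ℝ => ⌈-Real.log ε / Real.log 2⌉₊) (𝓝[>] 0) atTop :=
    tendsto_nat_ceil_atTop.comp (hlog.atTop_div_const hl2)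
  filter_upwards [hceil.eventually h, hlog.eventually_ge_atTop 0, self_mem_nhdsWithin]
    with ε hε hε1 hε0
  have hε0 : 0 < ε := hε0
  set k := ⌈-Real.log ε / Real.log 2⌉₊
  obtain ⟨m, hm1, hmle, hm⟩ := hε
  have hk1 : -Real.log ε ≤ k * Real.log 2 := (div_le_iff₀ hl2).1 (Nat.le_ceil _)
  have hk2 : k * Real.log 2 ≤ -Real.log ε + Real.log 2 := by
    have := (Nat.ceil_lt_add_one (div_nonneg hε1 hl2.le)).le
    calc (k : ℝ) * Real.log 2 ≤ (-Real.log ε / Real.log 2 + 1) * Real.log 2 := by gcongr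
      _ = _ := by field_simp
  have hkε : ((1 : ℝ) / 2) ^ k ≤ ε := by
    rw [← Real.log_le_log_iff (by positivity) hε0, Real.log_pow, one_div, Real.log_inv]
    linarith
  have hτ := returnTime_le hm1 (hm.trans_le hkε)
  obtain ⟨n, hn, hn1, -⟩ := exists_returnTime_eq (hτ.trans_lt (ENat.natCast_lt_top m))
  rw [hn] at hτ ⊢
  rw [ENat.toNat_natCast]
  have hnm : (n : ℝ) ≤ m := by exact_mod_cast hτ
  have hnpos : (0 : ℝ) < n := by exact_mod_cast hn1
  have hln : Real.log n ≤ (2 : ℝ) ^ (s * k) := by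
    rw [Real.log_le_iff_le_exp hnpos]
    exact hnm.trans hmle
  -- If τ_ε = 1, the iterated logarithm is the default value `Real.log 0 = 0`, and the bound is
  -- nonnegative for ε ≤ 1.
  rcases (Real.log_nonneg (by exact_mod_cast hn1 : (1 : ℝ) ≤ n)).eq_or_lt with h0 | hpos
  · rw [← h0, Real.log_zero]
    have : 0 ≤ s := by linarith
    positivity
  · have h1 := Real.log_le_log hpos hln
    rw [Real.log_rpow two_pos, mul_assoc] at h1
    have : s * (k * Real.log 2) ≤ s * (-Real.log ε + Real.log 2) := by gcongr
    linarith

lemma tendsto_log_log_returnTime_div (hne : ∀ n : ℕ, 1 ≤ n → walk X n ω ≠ 0)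
    (hlow : ∀ j : ℕ, ∀ᶠ n : ℕ in atTop,
      Real.log (n + 2) ^ (-((1 + 1 / ((j : ℝ) + 1)) / 2)) ≤ ‖walk X n ω‖)
    (hup : ∀ j : ℕ, ∀ᶠ k : ℕ in atTop, ∃ m : ℕ, 1 ≤ m ∧
      (m : ℝ) ≤ Real.exp ((2 : ℝ) ^ ((2 + 1 / ((j : ℝ) + 1)) * k)) ∧
      ‖walk X m ω‖ < (1 / 2) ^ k) :
    Tendsto (fun ε : ℝ => Real.log (Real.log ((returnTime X ε ω).toNat : ℝ)) / (-Real.log ε))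
      (𝓝[>] 0) (𝓝 2) := by
  have hfin : ∀ ε : ℝ, 0 < ε → returnTime X ε ω < ⊤ := fun ε hε =>
    returnTime_lt_top_of_eventually (hup 0) hε
  have hlog : Tendsto (fun ε : ℝ => -Real.log ε) (𝓝[>] 0) atTop :=
    tendsto_neg_atBot_atTop.comp Real.tendsto_log_nhdsGT_zero
  have hj0 : Tendsto (fun j : ℕ => 1 / ((j : ℝ) + 1)) atTop (𝓝 0) :=
    tendsto_one_div_add_atTop_nhds_zero_nat
  refine tendsto_order.2 ⟨fun a ha => ?_, fun a ha => ?_⟩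
  · have hj : Tendsto (fun j : ℕ => 2 / (1 + 1 / ((j : ℝ) + 1))) atTop (𝓝 2) := by
      have := (tendsto_const_nhds (x := (2 : ℝ))).div (hj0.const_add 1) (by norm_num)
      rwa [add_zero, div_one] at this
    obtain ⟨j, hja⟩ := (hj.eventually_const_lt ha).exists
    have hj1 : 0 < 1 / ((j : ℝ) + 1) := by positivity
    set s := 1 + 1 / ((j : ℝ) + 1)
    have hlim : Tendsto (fun ε : ℝ => 2 / s - Real.log 2 / (-Real.log ε)) (𝓝[>] 0)
        (𝓝 (2 / s)) := by
      simpa using (tendsto_const_nhds (x := 2 / s)).sub (hlog.const_div_atTop (Real.log 2))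
    filter_upwards [hlim.eventually_const_lt hja,
      eventually_le_log_log_returnTime hfin hne (by linarith) (hlow j),
      hlog.eventually_gt_atTop 0] with ε h1 h3 h4
    refine h1.trans_le ?_
    rw [le_div_iff₀ h4, sub_mul, div_mul_cancel₀ _ h4.ne']
    exact h3
  · have hj : Tendsto (fun j : ℕ => 2 + 1 / ((j : ℝ) + 1)) atTop (𝓝 2) := by
      simpa using hj0.const_add 2
    obtain ⟨j, hja⟩ := (hj.eventually_lt_const ha).exists
    have hj1 : 0 < 1 / ((j : ℝ) + 1) := by positivity
    set s := 2 + 1 / ((j : ℝ) + 1)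
    have hlim : Tendsto (fun ε : ℝ => s + s * Real.log 2 / (-Real.log ε)) (𝓝[>] 0) (𝓝 s) := by
      simpa using (tendsto_const_nhds (x := s)).add (hlog.const_div_atTop (s * Real.log 2))
    filter_upwards [hlim.eventually_lt_const hja,
      eventually_log_log_returnTime_le (by linarith) (hup j),
      hlog.eventually_gt_atTop 0] with ε h1 h3 h4
    refine lt_of_le_of_lt ?_ h1
    rw [div_le_iff₀ h4, add_mul, div_mul_cancel₀ _ h4.ne']
    exact h3

end

theorem theorem5 {Ω : Type*} [MeasurableSpace Ω] (P : Measure Ω) [IsProbabilityMeasure P]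
    (μ : Measure Plane) [IsProbabilityMeasure μ]
    (X : ℕ → Ω → Plane)
    (hlaw : ∀ i, HasLaw (X i) μ P)
    (hindep : iIndepFun X P)
    (hsecond : MemLp (fun x : Plane => x) 2 μ)
    (hmean : ∫ x, x ∂μ = 0)
    (hcov : IsUnit (planeCovMatrix μ))
    (hcramer : CramerCondition μ) :
    ∀ᵐ ω ∂P,
      (∀ ε : ℝ, 0 < ε → returnTime X ε ω < ⊤) ∧
      ((∀ n : ℕ, 1 ≤ n → walk X n ω ≠ 0) →
        Tendsto
          (fun ε : ℝ =>
            Real.log (Real.log ((returnTime X ε ω).toNat : ℝ)) / (-Real.log ε))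
          (𝓝[>] 0) (𝓝 2)) := by
  -- Restricting the exponents to 1 + 1/(j+1) and 2 + 1/(j+1) leaves only countably many null sets
  -- to discard.
  have hpos : ∀ j : ℕ, 0 < 1 / ((j : ℝ) + 1) := fun j => by positivity
  have hlow := ae_all_iff.2 fun j : ℕ => ae_eventually_log_rpow_le_norm_walk hlaw hindep hsecond
    hmean hcov hcramer (s := 1 + 1 / ((j : ℝ) + 1)) (by linarith [hpos j])
  have hup := ae_all_iff.2 fun j : ℕ => ae_eventually_exists_norm_walk_lt hlaw hindep hsecond
    hmean hcov hcramer (s := 2 + 1 / ((j : ℝ) + 1)) (by linarith [hpos j])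
  filter_upwards [hlow, hup] with ω h1 h3
  exact ⟨fun ε hε => returnTime_lt_top_of_eventually (h3 0) hε,
    fun hne => tendsto_log_log_returnTime_div hne h1 h3⟩
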